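/- **Setting.** There are $n$ players $1,\dots,n$; player $i$ has a private value $v_i>0$ per unit of a divisible good and a public budget $B_i\ge 0$. The environment is a polymatroid $P=\{x\in\mathbb R^n_{\ge 0} : \sum_{i\in S}x_i\le f(S)\ \text{for all } S\subseteq[n]\}$, where $f:2^{[n]}\to\mathbb R_{\ge0}$ is monotone and submodular. **Clinching step.** For promised allocations $\rho\in P$ and a demand vector $d\in[0,\infty]^n$ let $P_{\rho,d}=\{x\ge 0:\rho+x\in P,\ x\le d\}$ and, for $t\ge0$, $P^i_{\rho,d}(t)=\{x_{-i}\in\mathbb R_{\ge0}^{[n]\setminus i} : (t,x_{-i})\in P_{\rho,d}\}$. Player $i$ clinches $\delta_i=\sup\{t\ge 0 : P^i_{\rho,d}(t)=P^i_{\rho,d}(0)\}$. **Auction.** Fix a price increment $\varepsilon>0$ and reported values $v$. Start with prices $p_i=0$, promised allocations $\rho_i=0$, remaining budgets $b_i=B_i$ and $\hat\imath=1$. In each round: set the demands $d_i=b_i/p_i$ if $p_i<v_i$ and $d_i=0$ otherwise (with $d_i=\infty$ if $p_i=0<v_i$); compute all $\delta_i$ from $(P,\rho,d)$ by the clinching step;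 replace $\rho_i$ by $\rho_i+\delta_i$ and $b_i$ by $b_i-p_i\delta_i$; recompute $d$ from the current prices and the new $b$; raise $p_{\hat\imath}$ by $\varepsilon$ and move $\hat\imath$ cyclically to the next player. Repeat as long as the recomputed $d$ is nonzero. The allocation $x(v)$ is the final $\rho$, and the payment $p_i(v)$ is the total amount deducted from player $i$'s budget. **Theorem.** Let $P$ be a polymatroid, $B_i\ge0$ and $\varepsilon>0$. For every $v$ with all $v_i>0$ the auction is well defined (all suprema are finite), stops after finitely many rounds, and $x(v)\in P$. Moreover: 1. (Truthfulness, with public budgets) for all positive $v$, all $i$ and all $v_i'>0$: $v_i x_i(v_i,v_{-i})-p_i(v_i,v_{-i})\ge v_i x_i(v_i',v_{-i})-p_i(v_i',v_{-i})$. 2. (Individual rationality) $v_i x_i(v)-p_i(v)\ge0$ for all positive $v$ and all $i$. 3. (Budget feasibility) $p_i(v)\le B_i$ for all positive $v$ and all $i$. 4. (Pareto-optimality) for every positive $v$ with $\varepsilon<|v_i-v_j|$ whenever $v_i\ne v_j$, the outcome $(x,p)=(x(v),p(v))$ is Pareto-optimal: $x\in P$, $p\le B$, and there are no $x'\in P$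 and $p'\in\mathbb R^n$ with $p'\le B$ such that $v_ix'_i-p'_i\ge v_ix_i-p_i$ for all $i$ and $\sum_i p'_i\ge\sum_i p_i$, with at least one of these inequalities strict. -/

import Mathlib

noncomputable section

namespace PolyhedralClinching

/-- A subset of the nonnegative orthant is a polymatroid if it is cut out by the inequalities
`x(S) ≤ f(S)` of a nonnegative monotone submodular set function `f`. -/
def IsPolymatroid {n : ℕ} (P : Set (Fin n → ℝ)) : Prop :=
  ∃ f : Finset (Fin n) → ℝ,
    (∀ S, 0 ≤ f S) ∧
    (∀ S T, S ⊆ T → f S ≤ f T) ∧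
    (∀ S T, f (S ∪ T) + f (S ∩ T) ≤ f S + f T) ∧
    P = {x | (∀ i, 0 ≤ x i) ∧ ∀ S : Finset (Fin n), ∑ i ∈ S, x i ≤ f S}

/-! ### The clinching step -/

/-- The aggregate demand `P_{ρ,d} = {x ≥ 0 : ρ + x ∈ P, x ≤ d}`. Demands are extended reals, since
a player who still faces the price zero demands an unbounded amount. -/
def aggregateDemand {n : ℕ} (P : Set (Fin n → ℝ)) (ρ : Fin n → ℝ) (d : Fin n → EReal) :
    Set (Fin n → ℝ) :=
  {x | (∀ i, 0 ≤ x i) ∧ ρ + x ∈ P ∧ ∀ i, (x i : EReal) ≤ d i}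

/-- The vector `(t, y)` with `i`-th coordinate `t` and remaining coordinates `y`. -/
def insertCoord {n : ℕ} (i : Fin n) (t : ℝ) (y : {j : Fin n // j ≠ i} → ℝ) : Fin n → ℝ :=
  fun j => if h : j = i then t else y ⟨j, h⟩

/-- The demand set `P^i_{ρ,d}(t)` of the players other than `i` when player `i` is allocated `t`. -/
def demandSet {n : ℕ} (P : Set (Fin n → ℝ)) (ρ : Fin n → ℝ) (d : Fin n → EReal) (i : Fin n)
    (t : ℝ) : Set ({j : Fin n // j ≠ i} → ℝ) :=
  {y | (∀ j, 0 ≤ y j) ∧ insertCoord i t y ∈ aggregateDemand P ρ d}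

/-- The amounts that can be given to player `i` without changing the demand set of the others. -/
def clinchable {n : ℕ} (P : Set (Fin n → ℝ)) (ρ : Fin n → ℝ) (d : Fin n → EReal) (i : Fin n) :
    Set ℝ :=
  {t | 0 ≤ t ∧ demandSet P ρ d i t = demandSet P ρ d i 0}

/-- The clinching step: the vector `δ` of clinched amounts. -/
def clinch {n : ℕ} (P : Set (Fin n → ℝ)) (ρ : Fin n → ℝ) (d : Fin n → EReal) : Fin n → ℝ :=
  fun i => sSup (clinchable P ρ d i)

/-! ### The auction -/

/-- The variables of the auction: prices, promised allocations, remaining budgets, and the player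
whose price is raised next (players are numbered `0, …, n - 1`). -/
structure AuctionState (n : ℕ) where
  price : Fin n → ℝ
  alloc : Fin n → ℝ
  budget : Fin n → ℝ
  turn : ℕ

/-- The demands `d_i = B_i / p_i` if `p_i < v_i` and `d_i = 0` otherwise, for the current prices and
remaining budgets; a player with `p_i = 0 < v_i` demands `∞`. -/
def demand {n : ℕ} (v : Fin n → ℝ) (s : AuctionState n) : Fin n → EReal :=
  fun i =>
    if s.price i < v i then
      if s.price i = 0 then ⊤ else ((s.budget i / s.price i : ℝ) : EReal)
    else 0

def initialState {n : ℕ} (B : Fin n → ℝ) : AuctionState n where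
  price := fun _ => 0
  alloc := fun _ => 0
  budget := B
  turn := 0

/-- First half of a round: clinching at the current prices. -/
def clinchRound {n : ℕ} (P : Set (Fin n → ℝ)) (v : Fin n → ℝ) (s : AuctionState n) :
    AuctionState n where
  price := s.price
  alloc := fun i => s.alloc i + clinch P s.alloc (demand v s) i
  budget := fun i => s.budget i - s.price i * clinch P s.alloc (demand v s) i
  turn := s.turn

/-- Second half of a round: the price of a single player is raised by `ε`. -/
def raisePrice {n : ℕ} (ε : ℝ) (s : AuctionState n) : AuctionState n where
  price := fun i => if (i : ℕ) = s.turn then s.price i + ε else s.price i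
  alloc := s.alloc
  budget := s.budget
  turn := (s.turn + 1) % n

/-- The state at the beginning of round `k`. -/
def stateAt {n : ℕ} (P : Set (Fin n → ℝ)) (B : Fin n → ℝ) (ε : ℝ) (v : Fin n → ℝ) :
    ℕ → AuctionState n
  | 0 => initialState B
  | k + 1 => raisePrice ε (clinchRound P v (stateAt P B ε v k))

/-- The loop condition `d ≠ 0` fails at the end of round `k`. As in the algorithm, `d` is the vector
of demands recomputed after clinching and before the price is raised. -/
def StopsAt {n : ℕ} (P : Set (Fin n → ℝ)) (B : Fin n → ℝ) (ε : ℝ) (v : Fin n → ℝ) (k : ℕ) : Prop :=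
  ∀ i, demand v (clinchRound P v (stateAt P B ε v k)) i = 0

/-- The last round of the do-while loop (meaningful if the auction stops). -/
def lastRound {n : ℕ} (P : Set (Fin n → ℝ)) (B : Fin n → ℝ) (ε : ℝ) (v : Fin n → ℝ) : ℕ :=
  sInf {k | StopsAt P B ε v k}

def finalState {n : ℕ} (P : Set (Fin n → ℝ)) (B : Fin n → ℝ) (ε : ℝ) (v : Fin n → ℝ) :
    AuctionState n :=
  stateAt P B ε v (lastRound P B ε v + 1)

/-- The auction is well defined on the reports `v`: it stops after finitely many rounds, and all
the suprema in the clinching steps are finite. -/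
def WellDefined {n : ℕ} (P : Set (Fin n → ℝ)) (B : Fin n → ℝ) (ε : ℝ) (v : Fin n → ℝ) : Prop :=
  (∃ k, StopsAt P B ε v k) ∧
  ∀ k ≤ lastRound P B ε v, ∀ i,
    BddAbove (clinchable P (stateAt P B ε v k).alloc (demand v (stateAt P B ε v k)) i)

/-- The final allocation for the reports `v`. -/
def auctionAlloc {n : ℕ} (P : Set (Fin n → ℝ)) (B : Fin n → ℝ) (ε : ℝ) (v : Fin n → ℝ) :
    Fin n → ℝ :=
  (finalState P B ε v).alloc

/-- The payments for the reports `v`: the total amounts deducted from the budgets. -/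
def auctionPay {n : ℕ} (P : Set (Fin n → ℝ)) (B : Fin n → ℝ) (ε : ℝ) (v : Fin n → ℝ) :
    Fin n → ℝ :=
  fun i => B i - (finalState P B ε v).budget i

/-! ### Desirable properties

A mechanism is given by an allocation rule `x` and a payment rule `p`, which map reported (positive)
valuations to allocations and payments. Budgets are public, so they are not reported. -/

/-- Reporting the true value is a dominant strategy. -/
def IsTruthful {n : ℕ} (x p : (Fin n → ℝ) → Fin n → ℝ) : Prop :=
  ∀ v : Fin n → ℝ, (∀ j, 0 < v j) → ∀ (i : Fin n) (w : ℝ), 0 < w →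
    v i * x (Function.update v i w) i - p (Function.update v i w) i ≤ v i * x v i - p v i

def IsIndividuallyRational {n : ℕ} (x p : (Fin n → ℝ) → Fin n → ℝ) : Prop :=
  ∀ v : Fin n → ℝ, (∀ j, 0 < v j) → ∀ i, 0 ≤ v i * x v i - p v i

def IsBudgetFeasible {n : ℕ} (B : Fin n → ℝ) (p : (Fin n → ℝ) → Fin n → ℝ) : Prop :=
  ∀ v : Fin n → ℝ, (∀ j, 0 < v j) → ∀ i, p v i ≤ B i

/-- A feasible outcome `(x, p)` is Pareto-optimal for the valuations `v` if no other feasible outcome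
`(x', p')` is at least as good for all players and for the auctioneer, and better for one of them. -/
def IsParetoOptimal {n : ℕ} (P : Set (Fin n → ℝ)) (B v x p : Fin n → ℝ) : Prop :=
  x ∈ P ∧ (∀ i, p i ≤ B i) ∧
  ¬ ∃ x' p' : Fin n → ℝ, x' ∈ P ∧ (∀ i, p' i ≤ B i) ∧
    (∀ i, v i * x i - p i ≤ v i * x' i - p' i) ∧
    ∑ i, p i ≤ ∑ i, p' i ∧
    ((∃ i, v i * x i - p i < v i * x' i - p' i) ∨ ∑ i, p i < ∑ i, p' i)

end PolyhedralClinching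

end

namespace PolyhedralClinching

variable {n : ℕ}

/-! Everything rests on the lattice of tight sets: by submodularity, unions and intersections of
tight sets are tight. The central fact is `exists_base_eq_clinch`. Among the ways to sell everything
within the current demands, one gives player `i` exactly the clinched amount. If that amount is
positive, this base fills a tight set `T` avoiding `i` and all other demands outside `T`.

Hence the invariant "the remaining demands can absorb all that is left" survives every round: before
a price rises, the player concerned is given only the clinched amount, so any fall in this demand
does no harm. At the end demands vanish, so everything has been sold.

Incentives come from comparing two reports `l ≤ h` of one player. The runs coincide until the
player's price reaches `l`; afterwards only the high report buys, at prices between `l` and `h`.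

For Pareto-optimality, look at the last round in which `j` clinches. The set `T` of that round is
still tight at the end, and every player outside `T` other than `j` has by then received the whole
demand of that round. A player `i` outside `T` with value more than `ε` above that of `j` was still
active, so the whole budget is spent. Thus tight sets separate players with leftover budget from
cheaper winners (`exists_isTight_separating`). Merging them gives a tight set for each value
threshold, and summation by parts rules out any improvement (`isParetoOptimal_of_separated`). -/

/-- A nonnegative normalized submodular set function. -/
structure IsRankFunction (f : Finset (Fin n) → ℝ) : Prop where
  empty : f ∅ = 0
  nonneg : ∀ S, 0 ≤ f S
  submod : ∀ S T, f (S ∪ T) + f (S ∩ T) ≤ f S + f T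

/-- The polymatroid cut out by the inequalities `x(S) ≤ f(S)`. -/
def polytope (f : Finset (Fin n) → ℝ) : Set (Fin n → ℝ) :=
  {x | (∀ i, 0 ≤ x i) ∧ ∀ S : Finset (Fin n), ∑ i ∈ S, x i ≤ f S}

/-- The inequality `x(S) ≤ f(S)` is an equality. -/
def IsTight (f : Finset (Fin n) → ℝ) (x : Fin n → ℝ) (S : Finset (Fin n)) : Prop :=
  ∑ i ∈ S, x i = f S

theorem IsPolymatroid.exists_isRankFunction {P : Set (Fin n → ℝ)} (hP : IsPolymatroid P) :
    ∃ f : Finset (Fin n) → ℝ, IsRankFunction f ∧ P = polytope f := by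
  classical
  obtain ⟨f, h0, hm, hs, rfl⟩ := hP
  -- Resetting the value at `∅` to zero keeps submodularity, since it only lowers the left side when
  -- `S` and `T` are disjoint and nonempty; the constraint at `∅` is vacuous anyway.
  refine ⟨fun S => if S = ∅ then 0 else f S, ⟨by simp, fun S => ?_, fun S T => ?_⟩, ?_⟩
  · split_ifs
    exacts [le_rfl, h0 S]
  · by_cases hS : S = ∅
    · simp [hS]
    by_cases hT : T = ∅
    · simp [hT]
    have hU : S ∪ T ≠ ∅ := by simp [hS]
    rw [if_neg hS, if_neg hT, if_neg hU]
    have := hs S T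
    split_ifs
    · linarith [h0 (S ∩ T)]
    · exact this
  · ext x
    simp only [polytope, Set.mem_ofPred_eq]
    refine and_congr_right fun _ => forall_congr' fun S => ?_
    by_cases hS : S = ∅
    · simp [hS, h0]
    · simp [hS]

/-! ### Tight sets and bases of a polymatroid -/

section Tight

variable {f : Finset (Fin n) → ℝ} {x : Fin n → ℝ}

theorem sum_union_add_sum_inter (x : Fin n → ℝ) (S T : Finset (Fin n)) :
    ∑ i ∈ S ∪ T, x i + ∑ i ∈ S ∩ T, x i = ∑ i ∈ S, x i + ∑ i ∈ T, x i :=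
  Finset.sum_union_inter

/-- Submodularity squeezes: `f S + f T = x(S ∪ T) + x(S ∩ T) ≤ f (S ∪ T) + f (S ∩ T) ≤ f S + f T`,
so both constraints in the middle are equalities. -/
theorem IsTight.union (hf : IsRankFunction f) (hx : x ∈ polytope f) {S T : Finset (Fin n)}
    (hS : IsTight f x S) (hT : IsTight f x T) : IsTight f x (S ∪ T) := by
  have h1 := hf.submod S T
  have h2 := hx.2 (S ∪ T)
  have h3 := hx.2 (S ∩ T)
  have h4 := sum_union_add_sum_inter x S T
  unfold IsTight at *
  linarith

theorem IsTight.inter (hf : IsRankFunction f) (hx : x ∈ polytope f) {S T : Finset (Fin n)}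
    (hS : IsTight f x S) (hT : IsTight f x T) : IsTight f x (S ∩ T) := by
  have h1 := hf.submod S T
  have h2 := hx.2 (S ∪ T)
  have h3 := hx.2 (S ∩ T)
  have h4 := sum_union_add_sum_inter x S T
  unfold IsTight at *
  linarith

/-- Tight sets covering the elements of `A` and contained in `C` can be merged. -/
theorem exists_isTight_superset (hf : IsRankFunction f) (hx : x ∈ polytope f)
    (C : Set (Fin n)) (A : Finset (Fin n))
    (h : ∀ k ∈ A, ∃ S, IsTight f x S ∧ k ∈ S ∧ ∀ j ∈ S, j ∈ C) :
    ∃ T, IsTight f x T ∧ A ⊆ T ∧ ∀ j ∈ T, j ∈ C := by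
  classical
  induction A using Finset.induction_on with
  | empty => exact ⟨∅, by simp [IsTight, hf.empty], by simp, by simp⟩
  | insert a A _ ih =>
    obtain ⟨T, hT, hAT, hTC⟩ := ih fun k hk => h k (Finset.mem_insert_of_mem hk)
    obtain ⟨S, hS, haS, hSC⟩ := h a (Finset.mem_insert_self a A)
    refine ⟨S ∪ T, hS.union hf hx hT, ?_, ?_⟩
    · intro k hk
      rcases Finset.mem_insert.1 hk with rfl | hk
      · exact Finset.mem_union_left _ haS
      · exact Finset.mem_union_right _ (hAT hk)
    · intro j hj
      rcases Finset.mem_union.1 hj with hj | hj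
      · exact hSC j hj
      · exact hTC j hj

-- Moving mass from `j` to `k` raises the load only of sets containing `k` but not `j`. These
-- finitely many sets all have slack, so small moves stay feasible.
open Filter Topology in
theorem eventually_exchange_mem_polytope (hx : x ∈ polytope f) {k j : Fin n} (hj : 0 < x j)
    (h : ∀ S, IsTight f x S → k ∈ S → j ∈ S) :
    ∀ᶠ η : ℝ in 𝓝[>] 0, x + Pi.single k η - Pi.single j η ∈ polytope f := by
  classical
  have h1 : ∀ S : Finset (Fin n), ∀ᶠ η : ℝ in 𝓝[>] 0,
      (k ∈ S → j ∉ S → η ≤ f S - ∑ i ∈ S, x i) := by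
    intro S
    by_cases hS : k ∈ S ∧ j ∉ S
    · have hlt : 0 < f S - ∑ i ∈ S, x i := by
        rcases (hx.2 S).lt_or_eq with hlt | heq
        · linarith
        · exact absurd (h S heq hS.1) hS.2
      filter_upwards [Ioc_mem_nhdsGT hlt] with η hη _ _ using hη.2
    · exact Eventually.of_forall fun η h1 h2 => absurd ⟨h1, h2⟩ hS
  filter_upwards [eventually_all.2 h1, Ioc_mem_nhdsGT hj] with η hη hηj
  refine ⟨fun i => ?_, fun S => ?_⟩
  · have hk0 : 0 ≤ (Pi.single k η : Fin n → ℝ) i := by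
      rw [Pi.single_apply]; split_ifs <;> linarith [hηj.1]
    have := hx.1 i
    simp only [Pi.add_apply, Pi.sub_apply]
    rw [Pi.single_apply j]
    split_ifs with hij
    · subst hij; linarith [hηj.2]
    · linarith
  · have := hx.2 S
    have := hη S
    simp only [Pi.add_apply, Pi.sub_apply, Finset.sum_add_distrib, Finset.sum_sub_distrib,
      Finset.sum_pi_single']
    split_ifs with h1 h2 h2
    · linarith
    · linarith [this h1 h2]
    · linarith [hηj.1]
    · linarith

open Filter Topology in
theorem eventually_add_mem_polytope (hx : x ∈ polytope f) {k : Fin n}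
    (h : ∀ S, IsTight f x S → k ∉ S) :
    ∀ᶠ η : ℝ in 𝓝[>] 0, x + Pi.single k η ∈ polytope f := by
  classical
  have h1 : ∀ S : Finset (Fin n), ∀ᶠ η : ℝ in 𝓝[>] 0, (k ∈ S → η ≤ f S - ∑ i ∈ S, x i) := by
    intro S
    by_cases hS : k ∈ S
    · have hlt : 0 < f S - ∑ i ∈ S, x i := by
        rcases (hx.2 S).lt_or_eq with hlt | heq
        · linarith
        · exact absurd hS (h S heq)
      filter_upwards [Ioc_mem_nhdsGT hlt] with η hη _ using hη.2
    · exact Eventually.of_forall fun η h1 => absurd h1 hS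
  filter_upwards [eventually_all.2 h1, self_mem_nhdsWithin] with η hη (hpos : 0 < η)
  refine ⟨fun i => ?_, fun S => ?_⟩
  · have := hx.1 i
    simp only [Pi.add_apply]
    rw [Pi.single_apply]
    split_ifs <;> linarith
  · have := hx.2 S
    have := hη S
    simp only [Pi.add_apply, Finset.sum_add_distrib, Finset.sum_pi_single']
    split_ifs with h1
    · linarith [this h1]
    · linarith

theorem isClosed_polytope (f : Finset (Fin n) → ℝ) : IsClosed (polytope f) := by
  have : polytope f = (⋂ i, {x | 0 ≤ x i}) ∩ ⋂ S : Finset (Fin n), {x | ∑ i ∈ S, x i ≤ f S} := by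
    ext x; simp [polytope]
  rw [this]
  refine (isClosed_iInter fun i => ?_).inter (isClosed_iInter fun S => ?_)
  · exact isClosed_le continuous_const (continuous_apply i)
  · exact isClosed_le (by fun_prop) continuous_const

theorem isCompact_polytope (f : Finset (Fin n) → ℝ) : IsCompact (polytope f) := by
  refine (isCompact_Icc (a := (0 : Fin n → ℝ)) (b := fun i => f {i})).of_isClosed_subset
    (isClosed_polytope f) fun x hx => ⟨hx.1, fun i => by simpa using hx.2 {i}⟩

theorem polytope_mono {x y : Fin n → ℝ} (hy : y ∈ polytope f) (h0 : ∀ i, 0 ≤ x i)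
    (h : ∀ i, x i ≤ y i) : x ∈ polytope f :=
  ⟨h0, fun S => (Finset.sum_le_sum fun i _ => h i).trans (hy.2 S)⟩

/-- At a point of maximal total no coordinate can be raised, so each lies in a tight set; the union
of these sets is everything. -/
theorem exists_base (hf : IsRankFunction f) : ∃ x ∈ polytope f, ∑ i, x i = f Finset.univ := by
  obtain ⟨x, hx, hmax⟩ := (isCompact_polytope f).exists_isMaxOn
    ⟨0, by simp, by simpa using hf.nonneg⟩
    (f := fun x : Fin n → ℝ => ∑ i, x i) (by fun_prop)
  refine ⟨x, hx, ?_⟩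
  obtain ⟨T, hT, hTu, -⟩ := exists_isTight_superset hf hx Set.univ Finset.univ fun k _ => by
    by_contra! hk
    have hk' : ∀ S, IsTight f x S → k ∉ S := fun S hS hkS => by
      obtain ⟨j, _, hj⟩ := hk S hS hkS
      exact hj (Set.mem_univ j)
    obtain ⟨η, hη, hpos⟩ :=
      ((eventually_add_mem_polytope hx hk').and self_mem_nhdsWithin).exists
    have h1 := hmax hη
    simp only [Set.mem_ofPred_eq, Pi.add_apply, Finset.sum_add_distrib, Finset.sum_pi_single',
      Finset.mem_univ, if_true] at h1
    have : (0 : ℝ) < η := hpos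
    linarith
  rwa [Finset.univ_subset_iff.1 hTu] at hT

end Tight

/-! ### The clinching step -/

section Clinch

variable {f : Finset (Fin n) → ℝ} {ρ : Fin n → ℝ} {d : Fin n → EReal}

theorem isCompact_aggregateDemand (f : Finset (Fin n) → ℝ) (ρ : Fin n → ℝ) (d : Fin n → EReal) :
    IsCompact (aggregateDemand (polytope f) ρ d) := by
  have heq : aggregateDemand (polytope f) ρ d = (⋂ i, {x | 0 ≤ x i}) ∩
      ((fun x => ρ + x) ⁻¹' polytope f ∩ ⋂ i, {x | (x i : EReal) ≤ d i}) := by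
    ext x; simp [aggregateDemand]
  have hcl : IsClosed (aggregateDemand (polytope f) ρ d) := by
    rw [heq]
    refine (isClosed_iInter fun i => ?_).inter
      (((isClosed_polytope f).preimage (by fun_prop)).inter (isClosed_iInter fun i => ?_))
    · exact isClosed_le continuous_const (continuous_apply i)
    · exact isClosed_le (continuous_coe_real_ereal.comp (continuous_apply i)) continuous_const
  refine (isCompact_Icc (a := (0 : Fin n → ℝ)) (b := fun i => f {i} - ρ i)).of_isClosed_subset
    hcl fun x hx => ⟨hx.1, fun i => ?_⟩
  have := hx.2.1.2 {i}
  simp only [Finset.sum_singleton, Pi.add_apply] at this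
  linarith

theorem aggregateDemand_mono (h0 : (0 : Fin n → ℝ) ∈ aggregateDemand (polytope f) ρ d)
    {x y : Fin n → ℝ} (hy : y ∈ aggregateDemand (polytope f) ρ d) (hx : ∀ i, 0 ≤ x i)
    (h : ∀ i, x i ≤ y i) : x ∈ aggregateDemand (polytope f) ρ d := by
  refine ⟨hx, polytope_mono hy.2.1 (fun i => ?_) (fun i => ?_), fun i => ?_⟩
  · have := h0.2.1.1 i
    simp only [Pi.add_apply, Pi.zero_apply, add_zero] at this ⊢
    linarith [hx i]
  · simpa using h i
  · exact (EReal.coe_le_coe_iff.2 (h i)).trans (hy.2.2 i)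

theorem insertCoord_restrict (i : Fin n) (t : ℝ) (y : Fin n → ℝ) :
    insertCoord i t (fun j => y j) = Function.update y i t := by
  ext j
  by_cases h : j = i
  · subst h; simp [insertCoord]
  · simp [insertCoord, h]

/-- The aggregate demand is closed downwards, so giving `t` to player `i` can only shrink the demand
set of the others; one inclusion is all that has to be tested. -/
theorem mem_clinchable_iff (h0 : (0 : Fin n → ℝ) ∈ aggregateDemand (polytope f) ρ d)
    {i : Fin n} {t : ℝ} :
    t ∈ clinchable (polytope f) ρ d i ↔ 0 ≤ t ∧ ∀ y ∈ aggregateDemand (polytope f) ρ d, y i = 0 →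
      Function.update y i t ∈ aggregateDemand (polytope f) ρ d := by
  refine and_congr_right fun ht => ⟨fun h y hy hyi => ?_, fun h => ?_⟩
  · have h1 : (fun j : {j // j ≠ i} => y j) ∈ demandSet (polytope f) ρ d i 0 := by
      refine ⟨fun j => hy.1 j, ?_⟩
      rwa [insertCoord_restrict, ← hyi, Function.update_eq_self]
    rw [← h] at h1
    have := h1.2
    rwa [insertCoord_restrict] at this
  · ext y
    refine and_congr_right fun hy0 => ⟨fun hy => ?_, fun hy => ?_⟩
    · refine aggregateDemand_mono h0 hy (fun j => ?_) (fun j => ?_)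
      · by_cases hj : j = i
        · simp [insertCoord, hj]
        · simpa [insertCoord, hj] using hy0 ⟨j, hj⟩
      · by_cases hj : j = i
        · simpa [insertCoord, hj] using ht
        · simp [insertCoord, hj]
    · have := h _ hy (by simp [insertCoord])
      convert this using 1
      ext j
      by_cases hj : j = i
      · subst hj; simp [insertCoord]
      · simp [insertCoord, hj]

theorem zero_mem_clinchable (P : Set (Fin n → ℝ)) (ρ : Fin n → ℝ) (d : Fin n → EReal)
    (i : Fin n) : 0 ∈ clinchable P ρ d i := ⟨le_rfl, rfl⟩

theorem clinch_nonneg (P : Set (Fin n → ℝ)) (ρ : Fin n → ℝ) (d : Fin n → EReal) (i : Fin n) :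
    0 ≤ clinch P ρ d i :=
  Real.sSup_nonneg fun _ ht => ht.1

theorem bddAbove_clinchable (h0 : (0 : Fin n → ℝ) ∈ aggregateDemand (polytope f) ρ d)
    (i : Fin n) : BddAbove (clinchable (polytope f) ρ d i) := by
  refine ⟨f {i}, fun t ht => ?_⟩
  have h1 := (((mem_clinchable_iff h0).1 ht).2 0 h0 rfl).2.1.2 {i}
  have h2 := h0.2.1.1 i
  simp only [Finset.sum_singleton, Pi.add_apply, Function.update_self, Pi.zero_apply,
    add_zero] at h1 h2
  linarith

/-- The supremum is attained because the aggregate demand is closed. -/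
theorem clinch_mem_clinchable (h0 : (0 : Fin n → ℝ) ∈ aggregateDemand (polytope f) ρ d)
    (i : Fin n) : clinch (polytope f) ρ d i ∈ clinchable (polytope f) ρ d i := by
  refine (mem_clinchable_iff h0).2 ⟨clinch_nonneg _ _ _ _, fun y hy hyi => ?_⟩
  have hcl : IsClosed {t | Function.update y i t ∈ aggregateDemand (polytope f) ρ d} :=
    (isCompact_aggregateDemand f ρ d).isClosed.preimage (by fun_prop)
  have hsub : clinchable (polytope f) ρ d i ⊆
      {t | Function.update y i t ∈ aggregateDemand (polytope f) ρ d} :=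
    fun t ht => ((mem_clinchable_iff h0).1 ht).2 y hy hyi
  exact closure_minimal hsub hcl
    (csSup_mem_closure ⟨0, zero_mem_clinchable _ _ _ _⟩ (bddAbove_clinchable h0 i))

theorem update_clinch_mem (h0 : (0 : Fin n → ℝ) ∈ aggregateDemand (polytope f) ρ d)
    {y : Fin n → ℝ} (hy : y ∈ aggregateDemand (polytope f) ρ d) (i : Fin n) :
    Function.update y i (clinch (polytope f) ρ d i) ∈ aggregateDemand (polytope f) ρ d := by
  have h1 : Function.update y i 0 ∈ aggregateDemand (polytope f) ρ d := by
    refine aggregateDemand_mono h0 hy (fun j => ?_) (fun j => ?_) <;>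
      by_cases hj : j = i
    · simp [hj]
    · simpa [hj] using hy.1 j
    · simpa [hj] using hy.1 i
    · simp [hj]
  simpa using ((mem_clinchable_iff h0).1 (clinch_mem_clinchable h0 i)).2 _ h1 (by simp)

/-- Clinching is simultaneous, but each clinched amount is compatible with every feasible choice of
the others, so the coordinates can be raised one at a time. -/
theorem sup_clinch_mem (h0 : (0 : Fin n → ℝ) ∈ aggregateDemand (polytope f) ρ d)
    {y : Fin n → ℝ} (hy : y ∈ aggregateDemand (polytope f) ρ d) :
    (fun i => max (y i) (clinch (polytope f) ρ d i)) ∈ aggregateDemand (polytope f) ρ d := by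
  classical
  have key : ∀ s : Finset (Fin n),
      (fun i => if i ∈ s then max (y i) (clinch (polytope f) ρ d i) else y i) ∈
        aggregateDemand (polytope f) ρ d := by
    intro s
    induction s using Finset.induction_on with
    | empty => simpa using hy
    | insert a s ha ih =>
      rcases le_total (clinch (polytope f) ρ d a) (y a) with h | h
      · convert ih using 2 with i
        by_cases hi : i = a
        · subst hi; simp [ha, h]
        · simp [hi]
      · convert update_clinch_mem h0 ih a using 1
        ext i
        by_cases hi : i = a
        · subst hi; simp [h]
        · simp [hi]
  simpa using key Finset.univ

theorem clinch_mem (h0 : (0 : Fin n → ℝ) ∈ aggregateDemand (polytope f) ρ d) :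
    clinch (polytope f) ρ d ∈ aggregateDemand (polytope f) ρ d := by
  convert sup_clinch_mem h0 h0 using 1
  ext i
  simp [clinch_nonneg]

/-- Every base of the aggregate demand dominates the clinched amounts. -/
theorem clinch_le_of_base (h0 : (0 : Fin n → ℝ) ∈ aggregateDemand (polytope f) ρ d)
    {y : Fin n → ℝ} (hy : y ∈ aggregateDemand (polytope f) ρ d)
    (hb : ∑ i, (ρ i + y i) = f Finset.univ) (i : Fin n) : clinch (polytope f) ρ d i ≤ y i := by
  by_contra! hlt
  have h1 := (sup_clinch_mem h0 hy).2.1.2 Finset.univ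
  have h2 : ∑ i, (ρ i + y i) < ∑ i, (ρ + fun i => max (y i) (clinch (polytope f) ρ d i)) i := by
    refine Finset.sum_lt_sum (fun k _ => by simp) ⟨i, Finset.mem_univ i, ?_⟩
    simpa using hlt
  linarith

/-- If some base exists, some base gives player `i` exactly the clinched amount; if the latter is
positive, such a base saturates a set `T` not containing `i` and all demands outside `T`. -/
theorem exists_base_eq_clinch (hf : IsRankFunction f)
    (h0 : (0 : Fin n → ℝ) ∈ aggregateDemand (polytope f) ρ d)
    (hb : ∃ y ∈ aggregateDemand (polytope f) ρ d, ∑ i, (ρ i + y i) = f Finset.univ) (i : Fin n) :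
    ∃ y ∈ aggregateDemand (polytope f) ρ d, ∑ i, (ρ i + y i) = f Finset.univ ∧
      y i = clinch (polytope f) ρ d i ∧
      (0 < clinch (polytope f) ρ d i → ∃ T, i ∉ T ∧ IsTight f (ρ + y) T ∧
        ∀ k ∉ T, k ≠ i → (y k : EReal) = d k) := by
  classical
  have hcomp : IsCompact (aggregateDemand (polytope f) ρ d ∩
      {y | ∑ i, (ρ i + y i) = f Finset.univ}) :=
    (isCompact_aggregateDemand f ρ d).inter_right (isClosed_eq (by fun_prop) continuous_const)
  -- The base wanted is the one that is stingiest to player `i`.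
  obtain ⟨y, ⟨hy, hyb⟩, hmin⟩ := hcomp.exists_isMinOn hb (f := fun y : Fin n → ℝ => y i)
    (by fun_prop)
  simp only [Set.mem_ofPred_eq] at hyb
  have hle := clinch_le_of_base h0 hy hyb i
  have hρi : 0 ≤ ρ i := by simpa using h0.2.1.1 i
  have hT : 0 < y i → ∃ T, i ∉ T ∧ IsTight f (ρ + y) T ∧
      ∀ k ∉ T, k ≠ i → (y k : EReal) = d k := by
    intro hyi
    -- Each `k ≠ i` below its demand lies in a tight set avoiding `i`: otherwise a little could be
    -- moved from `i` to `k`, contradicting minimality. `T` merges these sets.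
    obtain ⟨T, hT, hA, hC⟩ := exists_isTight_superset hf hy.2.1 {i}ᶜ
      (Finset.univ.filter fun k => k ≠ i ∧ (y k : EReal) < d k) (fun k hk => by
        simp only [Finset.mem_filter, Finset.mem_univ, true_and] at hk
        obtain ⟨hki, hkd⟩ := hk
        by_contra! hcon
        have hcon' : ∀ S, IsTight f (ρ + y) S → k ∈ S → i ∈ S := fun S hS hkS => by
          obtain ⟨j, hj, hji⟩ := hcon S hS hkS
          simp only [Set.mem_compl_iff, Set.mem_singleton_iff, not_not] at hji
          exact hji ▸ hj
        have hpos : 0 < (ρ + y) i := by simp only [Pi.add_apply]; linarith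
        have hd : ∀ᶠ η : ℝ in nhdsWithin 0 (Set.Ioi 0), ((y k + η : ℝ) : EReal) < d k := by
          have hc : Continuous fun η : ℝ => ((y k + η : ℝ) : EReal) :=
            continuous_coe_real_ereal.comp (by fun_prop)
          have : Filter.Tendsto (fun η : ℝ => ((y k + η : ℝ) : EReal)) (nhds 0)
              (nhds (y k : EReal)) := by
            simpa using hc.tendsto 0
          exact nhdsWithin_le_nhds (this.eventually_lt_const hkd)
        obtain ⟨η, ⟨hη, hηd⟩, hηi⟩ :=
          (((eventually_exchange_mem_polytope hy.2.1 hpos hcon').and hd).and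
            (Ioc_mem_nhdsGT hyi)).exists
        have hmem : y + Pi.single k η - Pi.single i η ∈ aggregateDemand (polytope f) ρ d := by
          refine ⟨fun l => ?_, ?_, fun l => ?_⟩
          · have := hy.1 l
            by_cases hl : l = i
            · subst hl; simpa [Pi.single_apply, hki.symm] using hηi.2
            · by_cases hlk : l = k
              · subst hlk; simp [hl]; linarith [hηi.1]
              · simpa [hl, hlk] using this
          · convert hη using 1; abel
          · have := hy.2.2 l
            by_cases hl : l = i
            · subst hl
              refine (EReal.coe_le_coe_iff.2 ?_).trans this
              simpa [Pi.single_apply, hki.symm] using hηi.1.le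
            · by_cases hlk : l = k
              · subst hlk; simpa [hl] using hηd.le
              · simpa [hl, hlk] using this
        have hsum : ∑ l, (ρ l + (y + Pi.single k η - Pi.single i η : Fin n → ℝ) l) = f Finset.univ := by
          rw [← hyb]
          simp [Finset.sum_add_distrib, Finset.sum_sub_distrib]
        have := hmin ⟨hmem, hsum⟩
        simp only [Set.mem_ofPred_eq, Pi.sub_apply, Pi.add_apply, Pi.single_eq_same,
          Pi.single_eq_of_ne hki.symm] at this
        linarith [hηi.1])
    refine ⟨T, fun hiT => hC i hiT rfl, hT, fun k hk hki => ?_⟩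
    by_contra hne
    exact hk (hA (by simpa [hki] using lt_of_le_of_ne (hy.2.2 k) hne))
  have heq : y i = clinch (polytope f) ρ d i := by
    rcases (hy.1 i).eq_or_lt with h | hyi
    · exact le_antisymm (h ▸ clinch_nonneg _ _ _ _) hle
    obtain ⟨T, hiT, hT, hTd⟩ := hT hyi
    -- It remains to see that `y i` is clinchable. For `S` containing `i`, the load is at most `f (S
    -- ∩ T)` inside `T`, and at most that of `y` on `S \ T`, where demands are saturated. The latter
    -- is at most `f (S ∪ T) - f T`, and submodularity bounds the sum by `f S`.
    refine le_antisymm (le_csSup (bddAbove_clinchable h0 i) ?_) hle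
    refine (mem_clinchable_iff h0).2 ⟨hyi.le, fun z hz hzi => ?_⟩
    refine ⟨fun k => ?_, ⟨fun k => ?_, fun S => ?_⟩, fun k => ?_⟩
    · by_cases hk : k = i
      · subst hk; simpa using hyi.le
      · simpa [hk] using hz.1 k
    · by_cases hk : k = i
      · subst hk; simp only [Pi.add_apply, Function.update_self]; linarith
      · simpa [hk] using hz.2.1.1 k
    · by_cases hiS : i ∈ S
      · have hzle : ∀ k ∈ S \ T, (ρ + Function.update z i (y i)) k ≤ (ρ + y) k := by
          intro k hk
          by_cases hki : k = i
          · subst hki; simp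
          · have h1 := hz.2.2 k
            rw [← hTd k (Finset.mem_sdiff.1 hk).2 hki, EReal.coe_le_coe_iff] at h1
            simpa [hki] using h1
        have hin : ∑ k ∈ S ∩ T, (ρ + Function.update z i (y i)) k = ∑ k ∈ S ∩ T, (ρ + z) k := by
          refine Finset.sum_congr rfl fun k hk => ?_
          have : k ≠ i := fun h => hiT (h ▸ (Finset.mem_inter.1 hk).2)
          simp [this]
        have e1 : ∑ k ∈ S, (ρ + Function.update z i (y i)) k =
            ∑ k ∈ S ∩ T, (ρ + Function.update z i (y i)) k +
            ∑ k ∈ S \ T, (ρ + Function.update z i (y i)) k :=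
          (Finset.sum_inter_add_sum_sdiff S T _).symm
        have e2 : ∑ k ∈ S ∪ T, (ρ + y) k = ∑ k ∈ S \ T, (ρ + y) k + ∑ k ∈ T, (ρ + y) k := by
          rw [← Finset.sum_union Finset.sdiff_disjoint, Finset.sdiff_union_self_eq_union]
        have e3 := Finset.sum_le_sum hzle
        have e4 := hz.2.1.2 (S ∩ T)
        have e5 := hy.2.1.2 (S ∪ T)
        have e6 := hf.submod S T
        unfold IsTight at hT
        linarith
      · refine (Finset.sum_congr rfl fun k hk => ?_).trans_le (hz.2.1.2 S)
        have : k ≠ i := fun h => hiS (h ▸ hk)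
        simp [this]
    · by_cases hk : k = i
      · subst hk; simpa using hy.2.2 k
      · simpa [hk] using hz.2.2 k
  exact ⟨y, hy, hyb, heq, fun hpos => hT (heq ▸ hpos)⟩

theorem clinch_eq_zero (h0 : (0 : Fin n → ℝ) ∈ aggregateDemand (polytope f) ρ d) {i : Fin n}
    (hd : d i = 0) : clinch (polytope f) ρ d i = 0 := by
  have := (clinch_mem h0).2.2 i
  rw [hd] at this
  exact le_antisymm (by exact_mod_cast this) (clinch_nonneg _ _ _ _)

end Clinch

/-! ### One round of the auction and its invariants -/

section Round

variable {f : Finset (Fin n) → ℝ} {v : Fin n → ℝ} {s : AuctionState n} {ε : ℝ}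

/-- The invariants of the auction. The last one says that the remaining demands suffice to sell
everything. -/
structure Invariant (f : Finset (Fin n) → ℝ) (v : Fin n → ℝ) (s : AuctionState n) : Prop where
  price_nonneg : ∀ i, 0 ≤ s.price i
  budget_nonneg : ∀ i, 0 ≤ s.budget i
  zero_mem : (0 : Fin n → ℝ) ∈ aggregateDemand (polytope f) s.alloc (demand v s)
  exists_base : ∃ y ∈ aggregateDemand (polytope f) s.alloc (demand v s),
    ∑ i, (s.alloc i + y i) = f Finset.univ

theorem demand_nonneg (hp : ∀ i, 0 ≤ s.price i) (hb : ∀ i, 0 ≤ s.budget i) (i : Fin n) :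
    0 ≤ demand v s i := by
  unfold demand
  split_ifs
  · exact le_top
  · exact_mod_cast div_nonneg (hb i) (hp i)
  · exact le_rfl

theorem demand_of_le {i : Fin n} (h : v i ≤ s.price i) : demand v s i = 0 :=
  if_neg h.not_gt

theorem price_lt_of_clinch_pos
    (h0 : (0 : Fin n → ℝ) ∈ aggregateDemand (polytope f) s.alloc (demand v s)) {i : Fin n}
    (h : 0 < clinch (polytope f) s.alloc (demand v s) i) : s.price i < v i := by
  by_contra! hle
  exact h.ne' (clinch_eq_zero h0 (demand_of_le hle))

theorem price_mul_clinch_le (hp : ∀ i, 0 ≤ s.price i) (hb : ∀ i, 0 ≤ s.budget i)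
    (h0 : (0 : Fin n → ℝ) ∈ aggregateDemand (polytope f) s.alloc (demand v s)) (i : Fin n) :
    s.price i * clinch (polytope f) s.alloc (demand v s) i ≤ s.budget i := by
  rcases (clinch_nonneg (polytope f) s.alloc (demand v s) i).eq_or_lt with h | h
  · rw [← h, mul_zero]; exact hb i
  rcases (hp i).eq_or_lt with h1 | h1
  · rw [← h1, zero_mul]; exact hb i
  have h2 := (clinch_mem h0).2.2 i
  rw [demand, if_pos (price_lt_of_clinch_pos h0 h), if_neg h1.ne', EReal.coe_le_coe_iff,
    le_div_iff₀ h1] at h2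
  linarith

/-- Buying `δ` at a positive price `p` lowers the demand by exactly `δ`, as `(b - p δ) / p = b / p -
δ`. An infinite demand stays infinite, and a player with zero demand clinches nothing. -/
theorem le_demand_clinchRound_iff
    (h0 : (0 : Fin n → ℝ) ∈ aggregateDemand (polytope f) s.alloc (demand v s)) (i : Fin n)
    (t : ℝ) :
    (t : EReal) ≤ demand v (clinchRound (polytope f) v s) i ↔
      ((t + clinch (polytope f) s.alloc (demand v s) i : ℝ) : EReal) ≤ demand v s i := by
  by_cases hv : s.price i < v i
  · by_cases hp : s.price i = 0
    · rw [demand, demand, if_pos (by exact hv), if_pos (by exact hp), if_pos hv, if_pos hp]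
      simp
    · rw [demand, demand, if_pos (by exact hv), if_neg (by exact hp), if_pos hv, if_neg hp,
        EReal.coe_le_coe_iff, EReal.coe_le_coe_iff]
      change t ≤ (_ - s.price i * _) / s.price i ↔ _
      rw [sub_div, mul_div_cancel_left₀ _ hp, le_sub_iff_add_le]
  · have h1 : demand v s i = 0 := demand_of_le (not_lt.1 hv)
    have h2 : demand v (clinchRound (polytope f) v s) i = 0 := demand_of_le (not_lt.1 hv)
    rw [h1, h2, clinch_eq_zero h0 h1, add_zero]

/-- Clinching merely translates the aggregate demand, so feasibility after clinching can be tested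
before it. -/
theorem mem_aggregateDemand_clinchRound_iff
    (h0 : (0 : Fin n → ℝ) ∈ aggregateDemand (polytope f) s.alloc (demand v s))
    {y : Fin n → ℝ} (hy : ∀ i, 0 ≤ y i) :
    y ∈ aggregateDemand (polytope f) (clinchRound (polytope f) v s).alloc
        (demand v (clinchRound (polytope f) v s)) ↔
      y + clinch (polytope f) s.alloc (demand v s) ∈
        aggregateDemand (polytope f) s.alloc (demand v s) := by
  have e : (clinchRound (polytope f) v s).alloc + y =
      s.alloc + (y + clinch (polytope f) s.alloc (demand v s)) := by
    ext i
    simp only [clinchRound, Pi.add_apply]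
    ring
  refine ⟨fun h => ⟨fun i => add_nonneg (hy i) (clinch_nonneg _ _ _ _), e ▸ h.2.1, fun i => ?_⟩,
    fun h => ⟨hy, e ▸ h.2.1, fun i => ?_⟩⟩
  · exact (le_demand_clinchRound_iff h0 i _).1 (h.2.2 i)
  · exact (le_demand_clinchRound_iff h0 i _).2 (h.2.2 i)

theorem demand_raisePrice_of_ne {i : Fin n} (h : (i : ℕ) ≠ s.turn) :
    demand v (raisePrice ε s) i = demand v s i := by
  simp [demand, raisePrice, h]

theorem demand_raisePrice_le (hε : 0 < ε) (hp : ∀ i, 0 ≤ s.price i) (hb : ∀ i, 0 ≤ s.budget i)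
    (i : Fin n) : demand v (raisePrice ε s) i ≤ demand v s i := by
  by_cases h : (i : ℕ) = s.turn
  · by_cases hv : s.price i + ε < v i
    · have h1 : s.price i < v i := by linarith
      have hne : s.price i + ε ≠ 0 := by linarith [hp i]
      by_cases h0 : s.price i = 0
      · simp [demand, h0, h0 ▸ h1]
      · have hpos : 0 < s.price i := lt_of_le_of_ne (hp i) (Ne.symm h0)
        simp only [demand, raisePrice, h, if_true, hv, h1, hne, h0, if_false,
          EReal.coe_le_coe_iff]
        exact div_le_div_of_nonneg_left (hb i) hpos (by linarith)
    · rw [demand_of_le (s := raisePrice ε s) (by simpa [raisePrice, h] using hv)]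
      exact demand_nonneg hp hb i
  · exact (demand_raisePrice_of_ne h).le

theorem budget_clinchRound_nonneg (hs : Invariant f v s) (i : Fin n) :
    0 ≤ (clinchRound (polytope f) v s).budget i :=
  sub_nonneg.2 (price_mul_clinch_le hs.price_nonneg hs.budget_nonneg hs.zero_mem i)

theorem Invariant.next (hf : IsRankFunction f) (hε : 0 < ε) (hs : Invariant f v s) :
    Invariant f v (raisePrice ε (clinchRound (polytope f) v s)) := by
  have hb := budget_clinchRound_nonneg hs
  have hp : ∀ i, 0 ≤ (raisePrice ε (clinchRound (polytope f) v s)).price i := by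
    intro i
    have := hs.price_nonneg i
    change 0 ≤ if _ then s.price i + ε else s.price i
    split_ifs <;> linarith
  have hd := demand_nonneg (v := v) hp hb
  refine ⟨hp, hb, ⟨fun _ => le_rfl, ?_, fun i => by simpa using hd i⟩, ?_⟩
  · rw [add_zero]
    exact (clinch_mem hs.zero_mem).2.1
  -- The base is chosen to give the player whose price rises nothing beyond the clinched amount; all
  -- other demands are unaffected by the rise.
  obtain ⟨y, hy, hyb, hyt⟩ : ∃ y ∈ aggregateDemand (polytope f) s.alloc (demand v s),
      ∑ i, (s.alloc i + y i) = f Finset.univ ∧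
      ∀ i : Fin n, (i : ℕ) = s.turn → y i = clinch (polytope f) s.alloc (demand v s) i := by
    by_cases ht : ∃ i : Fin n, (i : ℕ) = s.turn
    · obtain ⟨i, hi⟩ := ht
      obtain ⟨y, hy, hyb, hyi, -⟩ := exists_base_eq_clinch hf hs.zero_mem hs.exists_base i
      refine ⟨y, hy, hyb, fun j hj => ?_⟩
      rwa [Fin.ext (hj.trans hi.symm)]
    · obtain ⟨y, hy, hyb⟩ := hs.exists_base
      exact ⟨y, hy, hyb, fun i hi => absurd ⟨i, hi⟩ ht⟩
  have hle := clinch_le_of_base hs.zero_mem hy hyb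
  have h1 : y - clinch (polytope f) s.alloc (demand v s) ∈ aggregateDemand (polytope f)
      (clinchRound (polytope f) v s).alloc (demand v (clinchRound (polytope f) v s)) := by
    refine (mem_aggregateDemand_clinchRound_iff hs.zero_mem fun i => sub_nonneg.2 (hle i)).2 ?_
    convert hy using 1
    ext i
    simp
  refine ⟨_, ⟨h1.1, h1.2.1, fun i => ?_⟩, ?_⟩
  · by_cases hi : (i : ℕ) = s.turn
    · simpa [hyt i hi] using hd i
    · rw [demand_raisePrice_of_ne (s := clinchRound (polytope f) v s) hi]
      exact h1.2.2 i
  · rw [← hyb]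
    refine Finset.sum_congr rfl fun i _ => ?_
    simp only [raisePrice, clinchRound, Pi.sub_apply]
    ring

theorem mem_aggregateDemand_of_next (hε : 0 < ε) (hs : Invariant f v s) {x : Fin n → ℝ}
    (hx : x - (raisePrice ε (clinchRound (polytope f) v s)).alloc ∈ aggregateDemand (polytope f)
      (raisePrice ε (clinchRound (polytope f) v s)).alloc
      (demand v (raisePrice ε (clinchRound (polytope f) v s)))) :
    x - s.alloc ∈ aggregateDemand (polytope f) s.alloc (demand v s) := by
  have h1 : x - (clinchRound (polytope f) v s).alloc ∈ aggregateDemand (polytope f)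
      (clinchRound (polytope f) v s).alloc (demand v (clinchRound (polytope f) v s)) :=
    ⟨hx.1, hx.2.1, fun i => (hx.2.2 i).trans
      (demand_raisePrice_le (s := clinchRound (polytope f) v s) hε hs.price_nonneg
        (budget_clinchRound_nonneg hs) i)⟩
  have h2 := (mem_aggregateDemand_clinchRound_iff hs.zero_mem h1.1).1 h1
  convert h2 using 1
  ext i
  simp only [clinchRound, Pi.sub_apply, Pi.add_apply]
  ring

end Round

/-! ### The whole run: termination, full sale, rationality and truthfulness -/

section Run

variable {f : Finset (Fin n) → ℝ} {B v : Fin n → ℝ} {ε : ℝ}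

theorem invariant_stateAt (hf : IsRankFunction f) (hB : ∀ i, 0 ≤ B i) (hε : 0 < ε)
    (hv : ∀ i, 0 < v i) (k : ℕ) : Invariant f v (stateAt (polytope f) B ε v k) := by
  induction k with
  | zero =>
    obtain ⟨x, hx, hxb⟩ := exists_base hf
    have hd : demand v (initialState B) = fun _ => ⊤ := by
      ext i
      simp [demand, initialState, hv i]
    refine ⟨fun _ => le_rfl, hB, ?_, x, ?_, ?_⟩
    · refine ⟨fun _ => le_rfl, ⟨fun i => by simp [stateAt, initialState], fun S => ?_⟩,
        fun i => by simp [stateAt, hd]⟩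
      simpa [stateAt, initialState] using hf.nonneg S
    · refine ⟨hx.1, ?_, fun i => by simp [stateAt, hd]⟩
      convert hx using 1
      ext i
      simp [stateAt, initialState]
    · simpa [stateAt, initialState] using hxb
  | succ k ih => exact ih.next hf hε

/-- Prices rise cyclically, so they depend only on the round and not on the reports. In particular
any two differ by at most `ε`. -/
theorem price_stateAt (P : Set (Fin n → ℝ)) (B : Fin n → ℝ) (ε : ℝ) (v : Fin n → ℝ)
    (hn : 0 < n) (k : ℕ) : ∀ i : Fin n, (stateAt P B ε v k).price i =
      ε * ((k / n : ℕ) + if (i : ℕ) < k % n then 1 else 0) := by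
  have hturn : ∀ k, (stateAt P B ε v k).turn = k % n := by
    intro k
    induction k with
    | zero => simp [stateAt, initialState]
    | succ k ih =>
      change ((stateAt P B ε v k).turn + 1) % n = _
      rw [ih, Nat.mod_add_mod]
  induction k with
  | zero => intro i; simp [stateAt, initialState]
  | succ k ih =>
    intro i
    change (if (i : ℕ) = (stateAt P B ε v k).turn then _ + ε else _) = _
    rw [hturn]
    change (if (i : ℕ) = k % n then (stateAt P B ε v k).price i + ε else
      (stateAt P B ε v k).price i) = _
    rw [ih i]
    have hkn := Nat.mod_lt k hn
    have hi := i.2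
    rcases Nat.lt_or_ge (k % n + 1) n with h | h
    · have h1 : (k + 1) % n = k % n + 1 := by
        rw [Nat.add_mod, Nat.mod_eq_of_lt (show 1 < n by omega), Nat.mod_eq_of_lt h]
      have h2 : (k + 1) / n = k / n := by
        rw [Nat.succ_div_of_not_dvd]
        rw [Nat.dvd_iff_mod_eq_zero, h1]; omega
      rw [h1, h2]
      split_ifs <;> first | omega | ring
    · have hk : k % n + 1 = n := by omega
      have hdvd : n ∣ k + 1 := by
        refine ⟨k / n + 1, ?_⟩
        have := Nat.mod_add_div k n
        rw [mul_add, mul_one]; omega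
      have h1 : (k + 1) % n = 0 := Nat.mod_eq_zero_of_dvd hdvd
      have h2 : (k + 1) / n = k / n + 1 := Nat.succ_div_of_dvd hdvd
      rw [h1, h2]
      push_cast
      split_ifs <;> first | omega | ring

theorem price_le_add (P : Set (Fin n → ℝ)) (B : Fin n → ℝ) (hε : 0 < ε) (v : Fin n → ℝ) (k : ℕ)
    (i j : Fin n) : (stateAt P B ε v k).price i ≤ (stateAt P B ε v k).price j + ε := by
  have hn : 0 < n := i.pos
  rw [price_stateAt P B ε v hn, price_stateAt P B ε v hn]
  split_ifs <;> nlinarith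

theorem price_mono (P : Set (Fin n → ℝ)) (B : Fin n → ℝ) (hε : 0 < ε) (v : Fin n → ℝ)
    (i : Fin n) : Monotone fun k => (stateAt P B ε v k).price i := by
  refine monotone_nat_of_le_succ fun k => ?_
  change _ ≤ if _ then (stateAt P B ε v k).price i + ε else (stateAt P B ε v k).price i
  split_ifs <;> linarith

theorem exists_stopsAt (P : Set (Fin n → ℝ)) (B : Fin n → ℝ) (hε : 0 < ε) (v : Fin n → ℝ) :
    ∃ k, StopsAt P B ε v k := by
  have h : ∀ i, ∃ m : ℕ, v i ≤ ε * m := fun i => by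
    obtain ⟨m, hm⟩ := exists_nat_ge (v i / ε)
    exact ⟨m, by rwa [div_le_iff₀' hε] at hm⟩
  choose m hm using h
  -- After this many rounds every price has been raised `∑ i, m i` times, hence is at least each
  -- value.
  refine ⟨(∑ i, m i) * n, fun i => demand_of_le ?_⟩
  change v i ≤ (stateAt P B ε v _).price i
  have hn : 0 < n := i.pos
  rw [price_stateAt P B ε v hn, Nat.mul_div_cancel _ hn, Nat.mul_mod_left]
  have h1 : m i ≤ ∑ i, m i := Finset.single_le_sum (fun _ _ => Nat.zero_le _) (Finset.mem_univ i)
  have h2 : (m i : ℝ) ≤ ((∑ i, m i : ℕ) : ℝ) := by exact_mod_cast h1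
  have := mul_le_mul_of_nonneg_left h2 hε.le
  simp only [not_lt_zero, if_false, add_zero]
  linarith [hm i]

/-- Once the demands vanish, allocations and budgets do not change any more. -/
theorem stateAt_eq_of_stopsAt (hf : IsRankFunction f) (hB : ∀ i, 0 ≤ B i) (hε : 0 < ε)
    (hv : ∀ i, 0 < v i) {k : ℕ} (hk : StopsAt (polytope f) B ε v k) {m : ℕ} (hm : k + 1 ≤ m) :
    (∀ i, demand v (stateAt (polytope f) B ε v m) i = 0) ∧
    (stateAt (polytope f) B ε v m).alloc = (stateAt (polytope f) B ε v (k + 1)).alloc ∧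
    (stateAt (polytope f) B ε v m).budget = (stateAt (polytope f) B ε v (k + 1)).budget := by
  have hinv := invariant_stateAt hf hB hε hv
  have hraise : ∀ m, (∀ i, demand v (clinchRound (polytope f) v
      (stateAt (polytope f) B ε v m)) i = 0) →
      ∀ i, demand v (stateAt (polytope f) B ε v (m + 1)) i = 0 := fun m h i =>
    le_antisymm ((demand_raisePrice_le (s := clinchRound _ _ _) hε (hinv m).price_nonneg
      (budget_clinchRound_nonneg (hinv m)) i).trans (h i).le)
      (demand_nonneg (hinv (m + 1)).price_nonneg (hinv (m + 1)).budget_nonneg i)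
  induction m, hm using Nat.le_induction with
  | base => exact ⟨hraise k hk, rfl, rfl⟩
  | succ m _ ih =>
    obtain ⟨hd, ha, hb⟩ := ih
    have hc : clinchRound (polytope f) v (stateAt (polytope f) B ε v m) =
        stateAt (polytope f) B ε v m := by
      have := fun i => clinch_eq_zero (hinv m).zero_mem (hd i)
      simp [clinchRound, this]
    refine ⟨hraise m (by rwa [hc]), ?_, ?_⟩
    · rw [← ha]
      change (clinchRound (polytope f) v (stateAt (polytope f) B ε v m)).alloc = _
      rw [hc]
    · rw [← hb]
      change (clinchRound (polytope f) v (stateAt (polytope f) B ε v m)).budget = _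
      rw [hc]

/-- This removes the stopping time: the outcome can be read off at any late round, so runs that stop
at different times can be compared at a common one. -/
theorem exists_outcome_eq (hf : IsRankFunction f) (hB : ∀ i, 0 ≤ B i) (hε : 0 < ε)
    (hv : ∀ i, 0 < v i) : ∃ K, ∀ m ≥ K,
      (∀ i, demand v (stateAt (polytope f) B ε v m) i = 0) ∧
      auctionAlloc (polytope f) B ε v = (stateAt (polytope f) B ε v m).alloc ∧
      auctionPay (polytope f) B ε v = fun i => B i - (stateAt (polytope f) B ε v m).budget i := by
  refine ⟨lastRound (polytope f) B ε v + 1, fun m hm => ?_⟩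
  have hlast : StopsAt (polytope f) B ε v (lastRound (polytope f) B ε v) :=
    Nat.sInf_mem (s := {k | StopsAt (polytope f) B ε v k}) (exists_stopsAt _ B hε v)
  obtain ⟨hd, ha, hb⟩ := stateAt_eq_of_stopsAt hf hB hε hv hlast hm
  exact ⟨hd, ha.symm, by rw [hb]; rfl⟩

theorem wellDefined (hf : IsRankFunction f) (hB : ∀ i, 0 ≤ B i) (hε : 0 < ε)
    (hv : ∀ i, 0 < v i) : WellDefined (polytope f) B ε v :=
  ⟨exists_stopsAt _ B hε v,
    fun k _ i => bddAbove_clinchable (invariant_stateAt hf hB hε hv k).zero_mem i⟩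

theorem auctionAlloc_mem (hf : IsRankFunction f) (hB : ∀ i, 0 ≤ B i) (hε : 0 < ε)
    (hv : ∀ i, 0 < v i) : auctionAlloc (polytope f) B ε v ∈ polytope f := by
  have := (invariant_stateAt hf hB hε hv (lastRound (polytope f) B ε v + 1)).zero_mem.2.1
  rwa [add_zero] at this

theorem auctionPay_le (hf : IsRankFunction f) (hB : ∀ i, 0 ≤ B i) (hε : 0 < ε)
    (hv : ∀ i, 0 < v i) (i : Fin n) : auctionPay (polytope f) B ε v i ≤ B i :=
  sub_le_self _
    ((invariant_stateAt hf hB hε hv (lastRound (polytope f) B ε v + 1)).budget_nonneg i)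

/-- Everything is sold. -/
theorem sum_auctionAlloc (hf : IsRankFunction f) (hB : ∀ i, 0 ≤ B i) (hε : 0 < ε)
    (hv : ∀ i, 0 < v i) : ∑ i, auctionAlloc (polytope f) B ε v i = f Finset.univ := by
  obtain ⟨K, hK⟩ := exists_outcome_eq hf hB hε hv
  obtain ⟨hd, ha, -⟩ := hK K le_rfl
  obtain ⟨y, hy, hyb⟩ := (invariant_stateAt hf hB hε hv K).exists_base
  rw [ha, ← hyb]
  refine Finset.sum_congr rfl fun i _ => ?_
  have h1 := hy.2.2 i
  rw [hd i] at h1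
  have h2 : y i = 0 := le_antisymm (by exact_mod_cast h1) (hy.1 i)
  rw [h2, add_zero]

/-- Every unit is bought at a price below the value, since a player whose price has reached the
value demands nothing. -/
theorem budget_sub_le (hf : IsRankFunction f) (hB : ∀ i, 0 ≤ B i) (hε : 0 < ε)
    (hv : ∀ i, 0 < v i) (k : ℕ) (i : Fin n) :
    B i - (stateAt (polytope f) B ε v k).budget i ≤
      v i * (stateAt (polytope f) B ε v k).alloc i := by
  induction k with
  | zero => simp [stateAt, initialState]
  | succ k ih =>
    have hs := invariant_stateAt hf hB hε hv k
    set s := stateAt (polytope f) B ε v k with hsdef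
    change B i - (s.budget i - s.price i * clinch (polytope f) s.alloc (demand v s) i) ≤
      v i * (s.alloc i + clinch (polytope f) s.alloc (demand v s) i)
    have : s.price i * clinch (polytope f) s.alloc (demand v s) i ≤
        v i * clinch (polytope f) s.alloc (demand v s) i := by
      rcases (clinch_nonneg (polytope f) s.alloc (demand v s) i).eq_or_lt with h | h
      · simp [← h]
      · exact mul_le_mul_of_nonneg_right (price_lt_of_clinch_pos hs.zero_mem h).le h.le
    linarith

theorem isIndividuallyRational (hf : IsRankFunction f) (hB : ∀ i, 0 ≤ B i) (hε : 0 < ε) :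
    IsIndividuallyRational (auctionAlloc (polytope f) B ε) (auctionPay (polytope f) B ε) :=
  fun _ hv i => sub_nonneg.2 (budget_sub_le hf hB hε hv _ i)

/-- Comparison of the runs in which player `i` reports `l` and `h ≥ l`: they agree while the price
of player `i` is below `l`, and after that only the high report buys, at prices between `l`
and `h`. -/
theorem compare_reports (hf : IsRankFunction f) (hB : ∀ i, 0 ≤ B i) (hε : 0 < ε)
    (hv : ∀ i, 0 < v i) (i : Fin n) {l h : ℝ} (hl : 0 < l) (hlh : l ≤ h) (k : ℕ) :
    let s := stateAt (polytope f) B ε (Function.update v i l) k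
    let t := stateAt (polytope f) B ε (Function.update v i h) k
    (t.price i < l → s = t) ∧
    l * (t.alloc i - s.alloc i) ≤ s.budget i - t.budget i ∧
    s.budget i - t.budget i ≤ h * (t.alloc i - s.alloc i) := by
  have hpos : ∀ a, 0 < a → ∀ j, 0 < Function.update v i a j := fun a ha j => by
    by_cases hj : j = i
    · subst hj; simpa using ha
    · simpa [hj] using hv j
  have hpr : ∀ w k, (stateAt (polytope f) B ε w k).price i =
      ε * ((k / n : ℕ) + if (i : ℕ) < k % n then 1 else 0) :=
    fun w k => price_stateAt _ B ε w i.pos k i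
  induction k with
  | zero => simp [stateAt]
  | succ k ih =>
    have hs := invariant_stateAt hf hB hε (hpos l hl) k
    have ht := invariant_stateAt hf hB hε (hpos h (hl.trans_le hlh)) k
    have hmono := price_mono (polytope f) B hε (Function.update v i h) i (Nat.le_succ k)
    have hpeq : (stateAt (polytope f) B ε (Function.update v i l) k).price i =
        (stateAt (polytope f) B ε (Function.update v i h) k).price i := by rw [hpr, hpr]
    simp only [stateAt] at ih hmono ⊢
    set s := stateAt (polytope f) B ε (Function.update v i l) k
    set t := stateAt (polytope f) B ε (Function.update v i h) k
    obtain ⟨ih1, ih2, ih3⟩ := ih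
    rcases lt_or_ge (t.price i) l with hlt | hge
    -- While the price is below both reports, the demand does not see which one was made, so equal
    -- states have equal successors.
    · have hst := ih1 hlt
      have hd : demand (Function.update v i l) s = demand (Function.update v i h) t := by
        rw [hst]
        ext j
        by_cases hj : j = i
        · subst hj
          simp [demand, hlt, hlt.trans_le hlh]
        · simp [demand, hj]
      have : clinchRound (polytope f) (Function.update v i l) s =
          clinchRound (polytope f) (Function.update v i h) t := by
        simp only [clinchRound, hd]
        rw [hst]
      simp [this]
    · have hcs : clinch (polytope f) s.alloc (demand (Function.update v i l) s) i = 0 :=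
        clinch_eq_zero hs.zero_mem (demand_of_le (by simpa [hpeq] using hge))
      refine ⟨fun hlt => absurd (hge.trans hmono) hlt.not_ge, ?_⟩
      simp only [raisePrice, clinchRound, hcs, mul_zero, sub_zero, add_zero]
      set δ := clinch (polytope f) t.alloc (demand (Function.update v i h) t) i with hδ
      have hδ0 : 0 ≤ δ := clinch_nonneg _ _ _ _
      have h1 : t.price i * δ ≤ h * δ := by
        rcases hδ0.eq_or_lt with h0 | h0
        · simp [← h0]
        · have := price_lt_of_clinch_pos ht.zero_mem h0
          rw [Function.update_self] at this
          exact mul_le_mul_of_nonneg_right this.le h0.le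
      have h2 : l * δ ≤ t.price i * δ := mul_le_mul_of_nonneg_right hge hδ0
      constructor <;> linarith

/-- Under-reporting forgoes only units priced at most `v i`; over-reporting adds only units priced
at least `v i`. -/
theorem isTruthful (hf : IsRankFunction f) (hB : ∀ i, 0 ≤ B i) (hε : 0 < ε) :
    IsTruthful (auctionAlloc (polytope f) B ε) (auctionPay (polytope f) B ε) := by
  intro v hv i w hw
  have hv' : ∀ j, 0 < Function.update v i w j := fun j => by
    by_cases hj : j = i
    · subst hj; simpa using hw
    · simpa [hj] using hv j
  obtain ⟨K, hK⟩ := exists_outcome_eq hf hB hε hv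
  obtain ⟨L, hL⟩ := exists_outcome_eq hf hB hε hv'
  obtain ⟨-, ha, hb⟩ := hK (max K L) (le_max_left _ _)
  obtain ⟨-, ha', hb'⟩ := hL (max K L) (le_max_right _ _)
  rw [ha, hb, ha', hb']
  dsimp only
  rcases le_total w (v i) with h | h
  · have := (compare_reports hf hB hε hv i hw h (max K L)).2.2
    simp only [Function.update_eq_self] at this
    linarith
  · have := (compare_reports hf hB hε hv i (hv i) h (max K L)).2.1
    simp only [Function.update_eq_self] at this
    linarith

end Run

/-! ### From separating tight sets to Pareto-optimality -/

section Pareto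

/-- Summation by parts: if all upper sums are nonpositive, so is the weighted sum. -/
theorem sum_mul_nonpos_of_upper_sum_nonpos {ι : Type*} (s : Finset ι) (v w : ι → ℝ)
    (hv : ∀ i ∈ s, 0 ≤ v i) (h : ∀ θ > 0, ∑ i ∈ s with θ ≤ v i, w i ≤ 0) :
    ∑ i ∈ s, v i * w i ≤ 0 := by
  classical
  induction s using Finset.strongInduction generalizing v with
  | H s ih =>
    rcases s.eq_empty_or_nonempty with rfl | hne
    · simp
    -- Peel off the smallest value: `v a` times the full sum is nonpositive, and `v - v a` is a
    -- nonnegative weight on `s.erase a` with the same upper sets.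
    obtain ⟨a, has, ha⟩ := s.exists_min_image v hne
    have h1 : ∑ i ∈ s.erase a, (v i - v a) * w i ≤ 0 := by
      refine ih _ (Finset.erase_ssubset has) (fun i => v i - v a)
        (fun i hi => sub_nonneg.2 (ha i (Finset.mem_of_mem_erase hi))) fun θ hθ => ?_
      convert h (θ + v a) (by linarith [hv a has]) using 2
      ext i
      simp only [Finset.mem_filter, Finset.mem_erase, le_sub_iff_add_le]
      refine ⟨fun ⟨⟨_, h2⟩, h3⟩ => ⟨h2, h3⟩, fun ⟨h2, h3⟩ => ⟨⟨?_, h2⟩, h3⟩⟩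
      rintro rfl
      linarith
    have h2 : v a * ∑ i ∈ s, w i ≤ 0 := by
      rcases (hv a has).eq_or_lt with h0 | h0
      · simp [← h0]
      · have := h _ h0
        rw [Finset.filter_true_of_mem ha] at this
        exact mul_nonpos_of_nonneg_of_nonpos h0.le this
    have h3 : ∑ i ∈ s, (v i - v a) * w i = ∑ i ∈ s.erase a, (v i - v a) * w i := by
      rw [← Finset.add_sum_erase s _ has]
      simp
    have h4 : ∑ i ∈ s, v i * w i = ∑ i ∈ s, (v i - v a) * w i + v a * ∑ i ∈ s, w i := by
      rw [Finset.mul_sum, ← Finset.sum_add_distrib]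
      exact Finset.sum_congr rfl fun i _ => by ring
    linarith

variable {f : Finset (Fin n) → ℝ} {B v x p : Fin n → ℝ}

/-- Tight sets that separate every player with remaining budget from every player of smaller value
who gets something yield a tight set for every value threshold. -/
theorem exists_isTight_threshold (hf : IsRankFunction f) (hx : x ∈ polytope f)
    (hxu : ∑ i, x i = f Finset.univ)
    (hsep : ∀ i j, v j < v i → 0 < x j → p i < B i → ∃ T, IsTight f x T ∧ i ∈ T ∧ j ∉ T) (θ : ℝ) :
    ∃ T, IsTight f x T ∧ (∀ i, θ ≤ v i → p i < B i → i ∈ T) ∧ ∀ j ∈ T, v j < θ → x j = 0 := by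
  classical
  -- For fixed `i`, intersect the separating sets over all cheaper winners `j`; afterwards take the
  -- union over `i`.
  have h1 : ∀ i, p i < B i → ∀ s : Finset (Fin n), (∀ j ∈ s, v j < v i ∧ 0 < x j) →
      ∃ T, IsTight f x T ∧ i ∈ T ∧ ∀ j ∈ s, j ∉ T := by
    intro i hi s
    induction s using Finset.induction_on with
    | empty => exact fun _ => ⟨Finset.univ, hxu, Finset.mem_univ i, by simp⟩
    | insert a s _ ih =>
      intro h
      obtain ⟨T, hT, hiT, hTs⟩ := ih fun j hj => h j (Finset.mem_insert_of_mem hj)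
      obtain ⟨ha, hxa⟩ := h a (Finset.mem_insert_self a s)
      obtain ⟨S, hS, hiS, haS⟩ := hsep i a ha hxa hi
      refine ⟨T ∩ S, hT.inter hf hx hS, Finset.mem_inter.2 ⟨hiT, hiS⟩, fun j hj hjT => ?_⟩
      rw [Finset.mem_inter] at hjT
      rcases Finset.mem_insert.1 hj with rfl | hj
      · exact haS hjT.2
      · exact hTs j hj hjT.1
  obtain ⟨T, hT, hA, hC⟩ := exists_isTight_superset hf hx {j | v j < θ → x j = 0}
    (Finset.univ.filter fun i => θ ≤ v i ∧ p i < B i) (fun i hi => by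
      simp only [Finset.mem_filter, Finset.mem_univ, true_and] at hi
      obtain ⟨T, hT, hiT, hTs⟩ := h1 i hi.2 (Finset.univ.filter fun j => v j < v i ∧ 0 < x j)
        (by simp)
      refine ⟨T, hT, hiT, fun j hj hjθ => ?_⟩
      by_contra hne
      refine hTs j ?_ hj
      simpa using ⟨hjθ.trans_le hi.1, lt_of_le_of_ne (hx.1 j) (Ne.symm hne)⟩)
  exact ⟨T, hT, fun i h1 h2 => hA (by simpa using ⟨h1, h2⟩), hC⟩

theorem isParetoOptimal_of_separated (hf : IsRankFunction f) (hv : ∀ i, 0 < v i)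
    (hx : x ∈ polytope f) (hp : ∀ i, p i ≤ B i) (hxu : ∑ i, x i = f Finset.univ)
    (hsep : ∀ i j, v j < v i → 0 < x j → p i < B i → ∃ T, IsTight f x T ∧ i ∈ T ∧ j ∉ T) :
    IsParetoOptimal (polytope f) B v x p := by
  classical
  refine ⟨hx, hp, ?_⟩
  rintro ⟨x', p', hx', hp', hu, hrev, hstrict⟩
  -- For a player with exhausted budget only a loss of goods counts: a gain cannot be turned into a
  -- higher payment. This makes `p' - p ≤ v * w` hold coordinatewise.
  set w : Fin n → ℝ := fun i => if p i < B i then x' i - x i else min 0 (x' i - x i) with hw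
  have hwle : ∀ i, w i ≤ x' i - x i := fun i => by
    simp only [hw]; split_ifs
    exacts [le_rfl, min_le_right _ _]
  have hupper : ∀ θ, ∑ i with θ ≤ v i, w i ≤ 0 := by
    intro θ
    obtain ⟨T, hT, hA, hC⟩ := exists_isTight_threshold hf hx hxu hsep θ
    -- Players of `T` below the threshold had nothing and cannot lose; players above it outside `T`
    -- are out of budget, so their `w` is nonpositive. The right side is at most zero because `T` is
    -- tight for `x`.
    have h1 : ∑ i with θ ≤ v i, w i ≤ ∑ i ∈ T, (x' i - x i) := by
      rw [Finset.sum_filter, ← Finset.sum_filter_add_sum_filter_not Finset.univ (· ∈ T)]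
      have e1 : ∑ i with i ∈ T, (if θ ≤ v i then w i else 0) ≤ ∑ i ∈ T, (x' i - x i) := by
        rw [Finset.filter_mem_eq_inter, Finset.univ_inter]
        refine Finset.sum_le_sum fun i hi => ?_
        split_ifs with hθ
        · exact hwle i
        · rw [hC i hi (not_le.1 hθ), sub_zero]
          exact hx'.1 i
      have e2 : ∑ i with i ∉ T, (if θ ≤ v i then w i else 0) ≤ 0 := by
        refine Finset.sum_nonpos fun i hi => ?_
        simp only [Finset.mem_filter, Finset.mem_univ, true_and] at hi
        split_ifs with hθ
        · simp only [hw]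
          rw [if_neg fun h => hi (hA i hθ h)]
          exact min_le_left _ _
        · exact le_rfl
      linarith
    have h2 := hx'.2 T
    rw [Finset.sum_sub_distrib] at h1
    unfold IsTight at hT
    linarith
  have hpw : ∀ i, p' i - p i ≤ v i * w i := by
    intro i
    have h1 := hu i
    have h2 := hp' i
    simp only [hw]
    split_ifs with hi
    · linarith
    · rcases min_choice 0 (x' i - x i) with h | h <;> rw [h] <;> linarith [hp i]
  have hsum : ∑ i, (p' i - p i) ≤ ∑ i, v i * w i := Finset.sum_le_sum fun i _ => hpw i
  have hvw : ∑ i, v i * w i ≤ 0 :=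
    sum_mul_nonpos_of_upper_sum_nonpos _ _ _ (fun i _ => (hv i).le) fun θ _ => hupper θ
  rw [Finset.sum_sub_distrib] at hsum
  rcases hstrict with ⟨i, hi⟩ | hlt
  swap
  · linarith
  by_cases hgain : p i < B i ∨ x' i ≤ x i
  · have hlt : p' i - p i < v i * w i := by
      simp only [hw]
      split_ifs with h
      · linarith
      · rw [min_eq_right (by linarith [hgain.resolve_left h])]
        linarith
    have := Finset.sum_lt_sum (fun i _ => hpw i) ⟨i, Finset.mem_univ i, hlt⟩
    rw [Finset.sum_sub_distrib] at this
    linarith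
  -- The remaining case is a gain in goods by a player out of budget. Truncation makes `w i`
  -- strictly smaller than this gain, so the total of `w` is negative, and the positive least value
  -- `v a` turns this into a strict loss of `∑ v * w`.
  · push Not at hgain
    obtain ⟨h1, h2⟩ := hgain
    obtain ⟨a, -, ha⟩ := Finset.univ.exists_min_image v ⟨i, Finset.mem_univ i⟩
    have e1 : ∑ k, (v k - v a) * w k ≤ 0 := by
      refine sum_mul_nonpos_of_upper_sum_nonpos _ _ _
        (fun k hk => sub_nonneg.2 (ha k hk)) fun θ _ => ?_
      simpa only [le_sub_iff_add_le] using hupper (θ + v a)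
    have e2 : ∑ k, w k < 0 := by
      have hlt : w i < x' i - x i := by
        simp only [hw]
        rw [if_neg h1.not_gt, min_eq_left (by linarith)]
        linarith
      have e3 := Finset.sum_lt_sum (fun i _ => hwle i) ⟨i, Finset.mem_univ i, hlt⟩
      rw [Finset.sum_sub_distrib] at e3
      linarith [hx'.2 Finset.univ]
    have e4 : ∑ k, v k * w k = ∑ k, (v k - v a) * w k + v a * ∑ k, w k := by
      rw [Finset.mul_sum, ← Finset.sum_add_distrib]
      exact Finset.sum_congr rfl fun i _ => by ring
    have e5 := mul_neg_of_pos_of_neg (hv a) e2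
    linarith

end Pareto

/-! ### Separating tight sets from the last clinching round -/

section Separation

variable {f : Finset (Fin n) → ℝ} {B v : Fin n → ℝ} {ε : ℝ}

/-- Demands only shrink apart from what is bought, so all later purchases together fit into the
present aggregate demand. -/
theorem sub_alloc_mem (hf : IsRankFunction f) (hB : ∀ i, 0 ≤ B i) (hε : 0 < ε)
    (hv : ∀ i, 0 < v i) {k m : ℕ} (hkm : k ≤ m) :
    (stateAt (polytope f) B ε v m).alloc - (stateAt (polytope f) B ε v k).alloc ∈
      aggregateDemand (polytope f) (stateAt (polytope f) B ε v k).alloc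
        (demand v (stateAt (polytope f) B ε v k)) := by
  induction hkm using Nat.decreasingInduction with
  | self =>
    rw [sub_self]
    exact (invariant_stateAt hf hB hε hv m).zero_mem
  | of_succ k _ ih => exact mem_aggregateDemand_of_next hε (invariant_stateAt hf hB hε hv k) ih

/-- Prices never fall, so each later unit costs at least the present price. -/
theorem budget_le_sub (hε : 0 < ε) {k m : ℕ} (hkm : k ≤ m) (i : Fin n) :
    (stateAt (polytope f) B ε v m).budget i ≤ (stateAt (polytope f) B ε v k).budget i -
      (stateAt (polytope f) B ε v k).price i *
        ((stateAt (polytope f) B ε v m).alloc i - (stateAt (polytope f) B ε v k).alloc i) := by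
  induction m, hkm using Nat.le_induction with
  | base => simp
  | succ m hkm ih =>
    have hmono := price_mono (polytope f) B hε v i hkm
    simp only at hmono
    set s := stateAt (polytope f) B ε v m with hs
    change s.budget i - s.price i * clinch (polytope f) s.alloc (demand v s) i ≤
      _ - _ * (s.alloc i + clinch (polytope f) s.alloc (demand v s) i - _)
    have := mul_le_mul_of_nonneg_right hmono (clinch_nonneg (polytope f) s.alloc (demand v s) i)
    linarith

/-- A player who ends up with something has a last round in which something is clinched. -/
theorem exists_last_clinch (f : Finset (Fin n) → ℝ) (B v : Fin n → ℝ) (ε : ℝ) (j : Fin n)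
    (m : ℕ) (hm : (stateAt (polytope f) B ε v m).alloc j ≠ 0) :
    ∃ k ≤ m, 0 < clinch (polytope f) (stateAt (polytope f) B ε v k).alloc
        (demand v (stateAt (polytope f) B ε v k)) j ∧
      (stateAt (polytope f) B ε v m).alloc j = (stateAt (polytope f) B ε v k).alloc j +
        clinch (polytope f) (stateAt (polytope f) B ε v k).alloc
          (demand v (stateAt (polytope f) B ε v k)) j := by
  induction m with
  | zero => exact absurd rfl hm
  | succ m ih =>
    have hstep : (stateAt (polytope f) B ε v (m + 1)).alloc j =
        (stateAt (polytope f) B ε v m).alloc j +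
          clinch (polytope f) (stateAt (polytope f) B ε v m).alloc
            (demand v (stateAt (polytope f) B ε v m)) j := rfl
    rcases (clinch_nonneg (polytope f) (stateAt (polytope f) B ε v m).alloc
      (demand v (stateAt (polytope f) B ε v m)) j).eq_or_lt with h | h
    · rw [← h, add_zero] at hstep
      rw [hstep] at hm ⊢
      obtain ⟨k, hk, h1, h2⟩ := ih hm
      exact ⟨k, hk.trans m.le_succ, h1, h2⟩
    · exact ⟨m, m.le_succ, h, hstep⟩

theorem exists_isTight_separating (hf : IsRankFunction f) (hB : ∀ i, 0 ≤ B i) (hε : 0 < ε)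
    (hv : ∀ i, 0 < v i) {i j : Fin n} (hij : ε < v i - v j)
    (hxj : 0 < auctionAlloc (polytope f) B ε v j)
    (hpi : auctionPay (polytope f) B ε v i < B i) :
    ∃ T, IsTight f (auctionAlloc (polytope f) B ε v) T ∧ i ∈ T ∧ j ∉ T := by
  classical
  have hxu := sum_auctionAlloc hf hB hε hv
  obtain ⟨m, hm⟩ := exists_outcome_eq hf hB hε hv
  obtain ⟨-, hx, hp⟩ := hm m le_rfl
  rw [hx] at hxj hxu ⊢
  rw [hp] at hpi
  obtain ⟨k, hkm, hδ, hlast⟩ := exists_last_clinch f B v ε j m hxj.ne'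
  have hs := invariant_stateAt hf hB hε hv k
  have hz := sub_alloc_mem hf hB hε hv hkm
  have hbud := budget_le_sub (f := f) (B := B) (v := v) hε hkm i
  have hprice := price_le_add (polytope f) B hε v k i j
  set s := stateAt (polytope f) B ε v k
  set x := (stateAt (polytope f) B ε v m).alloc
  have hpj := price_lt_of_clinch_pos hs.zero_mem hδ
  obtain ⟨y, hy, hyb, hyj, hyT⟩ := exists_base_eq_clinch hf hs.zero_mem hs.exists_base j
  obtain ⟨T, hjT, hT, hTd⟩ := hyT hδ
  -- Outside `T` the base `y` meets the full demand, which bounds later purchases; for `j` there is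
  -- equality because this is its last clinch. Both allocations have the same total and `T` is tight
  -- for the base, so `x` is tight on `T` and equals the base outside it.
  have hzle : ∀ l ∈ Tᶜ, x l ≤ s.alloc l + y l := by
    intro l hl
    by_cases hlj : l = j
    · subst hlj; linarith
    · have h1 := hz.2.2 l
      rw [← hTd l (Finset.mem_compl.1 hl) hlj, EReal.coe_le_coe_iff, Pi.sub_apply] at h1
      linarith
  have hxT : ∑ l ∈ T, x l ≤ f T := by
    simpa using hz.2.1.2 T
  have hyT : ∑ l ∈ T, (s.alloc l + y l) = f T := hT
  have e1 := Finset.sum_add_sum_compl T x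
  have e2 := Finset.sum_add_sum_compl T fun l => s.alloc l + y l
  have e3 := Finset.sum_le_sum hzle
  refine ⟨T, show _ = _ by linarith, ?_, hjT⟩
  by_contra hiT
  have heq : ∀ l ∈ Tᶜ, x l = s.alloc l + y l :=
    (Finset.sum_eq_sum_iff_of_le hzle).1 (by linarith)
  have hi := heq i (Finset.mem_compl.2 hiT)
  have hne : i ≠ j := by rintro rfl; linarith
  have hid := hTd i hiT hne
  -- Player `i` is still active: the price of `i` is at most that of `j` plus `ε`, hence below `v j
  -- + ε < v i`. The demand is met by a real amount, so it is finite, and buying it at the present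
  -- price or more leaves no budget.
  rw [demand, if_pos (by linarith)] at hid
  split_ifs at hid with h0
  · exact EReal.coe_ne_top _ hid
  · rw [EReal.coe_eq_coe_iff, eq_div_iff h0] at hid
    rw [hi] at hbud
    linarith

end Separation

end PolyhedralClinching

theorem mainTheorem1 (n : ℕ) (P : Set (Fin n → ℝ)) (hP : PolyhedralClinching.IsPolymatroid P)
    (B : Fin n → ℝ) (hB : ∀ i, 0 ≤ B i) (ε : ℝ) (hε : 0 < ε) :
    (∀ v : Fin n → ℝ, (∀ i, 0 < v i) →
      PolyhedralClinching.WellDefined P B ε v ∧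
      PolyhedralClinching.auctionAlloc P B ε v ∈ P) ∧
    PolyhedralClinching.IsTruthful (PolyhedralClinching.auctionAlloc P B ε)
      (PolyhedralClinching.auctionPay P B ε) ∧
    PolyhedralClinching.IsIndividuallyRational (PolyhedralClinching.auctionAlloc P B ε)
      (PolyhedralClinching.auctionPay P B ε) ∧
    PolyhedralClinching.IsBudgetFeasible B (PolyhedralClinching.auctionPay P B ε) ∧
    (∀ v : Fin n → ℝ, (∀ i, 0 < v i) → (∀ i j, v j < v i → ε < v i - v j) →
      PolyhedralClinching.IsParetoOptimal P B v (PolyhedralClinching.auctionAlloc P B ε v)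
        (PolyhedralClinching.auctionPay P B ε v)) := by
  obtain ⟨f, hf, rfl⟩ := hP.exists_isRankFunction
  open PolyhedralClinching in
  exact ⟨fun v hv => ⟨wellDefined hf hB hε hv, auctionAlloc_mem hf hB hε hv⟩,
    isTruthful hf hB hε, isIndividuallyRational hf hB hε,
    fun v hv i => auctionPay_le hf hB hε hv i,
    fun v hv hgap => isParetoOptimal_of_separated hf hv (auctionAlloc_mem hf hB hε hv)
      (auctionPay_le hf hB hε hv) (sum_auctionAlloc hf hB hε hv)
      fun i j hij hxj hpi => exists_isTight_separating hf hB hε hv (hgap i j hij) hxj hpi⟩
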